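/- For a filter $c\in\mathbb R^\ell$ let $T(c)\in\mathbb R^{n\times n}$ be the circulant convolution matrix whose row $r$ has the entries $c_1,\dots,c_\ell$ in columns $r,r+1,\dots,r+\ell-1$ (modulo $n$). Let $U\in\mathbb R^{n\times n_1}$ be a fixed linear (e.g. upsampling or identity) operator and $B=[b_1,\dots,b_k]\in\mathbb R^{n_1\times k}$ a fixed input. The one-layer deep decoder is $$G(C)=\mathrm{relu}\Big(\Big[\sum_{j=1}^k T(c_{1j})Ub_j,\;\dots,\;\sum_{j=1}^k T(c_{kj})Ub_j\Big]\Big)\,c^{(2)}\in\mathbb R^n ,$$ with $\mathrm{relu}$ acting entrywise and $c^{(2)}\in\mathbb R^k$. In the case of parameterized filters, the parameters $C$ are all the filters $c_{ij}\in\mathbb R^\ell$ together with $c^{(2)}$. In the case of fixed filters, $c_{ij}=\gamma_{ij}g_{ij}$ with given $g_{ij}\in\mathbb R^\ell$, and the parameters $C$ are the scalars $\gamma_{ij}\in\mathbb R$ together with $c^{(2)}$. There are universal constants $K,\kappa>0$ such that the following holds for all $m,n,n_1,k,\ell$, all $U$, $B$ (and all $g_{ij}$ in the fixed case). Suppose that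 $$m\ \ge\ \begin{cases}K\,\ell k^2\log n & \text{if the filters are parameters},\\ K\,k^2\log n & \text{if the filters are fixed}.\end{cases}$$ Fix a signal $x^*\in\mathbb R^n$, a noise vector $\eta\in\mathbb R^m$ and $\varepsilon\ge 0$. Let $A\in\mathbb R^{m\times n}$ have i.i.d. Gaussian entries with mean $0$ and variance $1/m$, and let $y=Ax^*+\eta$. Then, with probability at least $1-e^{-\kappa m}$ over $A$, every $\hat C$ that minimizes $\|y-AG(C)\|_2$ over all $C$ to within an additive $\varepsilon$ of the optimum satisfies $$\|G(\hat C)-x^*\|_2\ \le\ 6\,\inf_{C}\|G(C)-x^*\|_2+\tfrac32\|\eta\|_2+2\varepsilon .$$ -/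

import Mathlib

open scoped Matrix NNReal
open MeasureTheory ProbabilityTheory

namespace DeepDecoder

noncomputable section

/-- The `n × n` convolution (circulant) matrix `T(c)` of a filter `c ∈ ℝ^ℓ`: row `r` carries
`c_0, c_1, …, c_{ℓ-1}` in the columns `r, r+1, …, r+ℓ-1`, taken modulo `n`. -/
def convMatrix (n : ℕ) {l : ℕ} (c : Fin l → ℝ) : Matrix (Fin n) (Fin n) ℝ :=
  Matrix.of fun r s => ∑ t : Fin l, if ((r : ℕ) + (t : ℕ)) % n = (s : ℕ) then c t else 0

/-- The channels after the convolutional layer: channel `i` is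
`relu (∑ j, T(c i j) U b_j)`, with `b_j` the `j`-th column of the input volume `B`,
`U` the (linear) upsampling operator and `relu` acting entrywise. -/
def channels {n n₁ k l : ℕ} (U : Matrix (Fin n) (Fin n₁) ℝ) (B : Matrix (Fin n₁) (Fin k) ℝ)
    (c : Fin k → Fin k → Fin l → ℝ) : Matrix (Fin n) (Fin k) ℝ :=
  Matrix.of fun r i =>
    max 0 ((∑ j : Fin k, convMatrix n (c i j) *ᵥ (U *ᵥ (fun p => B p j))) r)

/-- The one-layer deep decoder with parameterized filters: the parameters are all the filters
`c i j ∈ ℝ^ℓ` and the output weights `c₂ ∈ ℝ^k`. -/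
def decoder {n n₁ k : ℕ} (l : ℕ) (U : Matrix (Fin n) (Fin n₁) ℝ)
    (B : Matrix (Fin n₁) (Fin k) ℝ)
    (C : (Fin k → Fin k → Fin l → ℝ) × (Fin k → ℝ)) : EuclideanSpace ℝ (Fin n) :=
  WithLp.toLp 2 (channels U B C.1 *ᵥ C.2)

/-- The one-layer deep decoder with fixed filters `g i j ∈ ℝ^ℓ`: the parameters are the scalar
coefficients `c i j`, multiplying the fixed filters, and the output weights `c₂ ∈ ℝ^k`. -/
def fixedDecoder {n n₁ k l : ℕ} (U : Matrix (Fin n) (Fin n₁) ℝ)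
    (B : Matrix (Fin n₁) (Fin k) ℝ) (g : Fin k → Fin k → Fin l → ℝ)
    (C : (Fin k → Fin k → ℝ) × (Fin k → ℝ)) : EuclideanSpace ℝ (Fin n) :=
  decoder l U B (fun i j => C.1 i j • g i j, C.2)

/-- The law of an `m × n` random matrix with i.i.d. `N(0, 1/m)` entries. -/
def gaussianMatrixLaw (m n : ℕ) : Measure (Fin m → Fin n → ℝ) :=
  Measure.pi fun _ => Measure.pi fun _ => gaussianReal 0 (1 / (m : ℝ≥0))

/-- The residual `‖y - A x‖₂`. -/
def residual {m n : ℕ} (A : Matrix (Fin m) (Fin n) ℝ) (y : EuclideanSpace ℝ (Fin m))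
    (x : EuclideanSpace ℝ (Fin n)) : ℝ :=
  ‖y - Matrix.toEuclideanLin A x‖

/-- `Chat` minimizes `C ↦ ‖y - A G(C)‖₂` to within an additive `ε` of the optimum. -/
def IsApproxMinimizer {m n : ℕ} {Θ : Type} (G : Θ → EuclideanSpace ℝ (Fin n))
    (A : Matrix (Fin m) (Fin n) ℝ) (y : EuclideanSpace ℝ (Fin m)) (ε : ℝ) (Chat : Θ) : Prop :=
  residual A y (G Chat) ≤ (⨅ C : Θ, residual A y (G C)) + ε

/-- The set of measurement matrices (as arrays of entries) for which every `ε`-approximate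
minimizer of `‖y - A G(C)‖₂`, where `y = A x* + η`, obeys the recovery bound. -/
def recoveryEvent {m n : ℕ} {Θ : Type} (G : Θ → EuclideanSpace ℝ (Fin n))
    (xstar : EuclideanSpace ℝ (Fin n)) (η : EuclideanSpace ℝ (Fin m)) (ε : ℝ) :
    Set (Fin m → Fin n → ℝ) :=
  {a | ∀ Chat : Θ,
    IsApproxMinimizer G (Matrix.of a) (Matrix.toEuclideanLin (Matrix.of a) xstar + η) ε Chat →
      ‖G Chat - xstar‖ ≤ 6 * (⨅ C : Θ, ‖G C - xstar‖) + (3 / 2) * ‖η‖ + 2 * ε}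

/-- For each fixed signal `x*`, noise `η` and accuracy `ε ≥ 0`, the recovery bound holds with
probability at least `1 - exp (-c m)` over the Gaussian `m × n` matrix `A`. -/
def RecoversWithHighProb {n : ℕ} {Θ : Type} (m : ℕ) (c : ℝ)
    (G : Θ → EuclideanSpace ℝ (Fin n)) : Prop :=
  ∀ (xstar : EuclideanSpace ℝ (Fin n)) (η : EuclideanSpace ℝ (Fin m)) (ε : ℝ), 0 ≤ ε →
    ∃ E : Set (Fin m → Fin n → ℝ), MeasurableSet E ∧ E ⊆ recoveryEvent G xstar η ε ∧
      1 - Real.exp (-(c * m)) ≤ (gaussianMatrixLaw m n).real E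

end

end DeepDecoder

/-! Once the activation pattern of every channel is frozen, the decoder is linear in the products of
output weight and filter. Hence its range lies in a union of subspaces of dimension at most `d = k *
finrank E`, where `E` is the parameter space of one channel (`d` is `k²l` or `k²`). Each channel's
patterns are sign patterns of a linear map, a family of VC dimension at most `finrank E`, so by
Sauer–Shelah there are at most `(n + 1) ^ d` subspaces (`card_signPatterns_le`).

After `x*` is adjoined to each subspace, every error vector lies in one of them. A 1/32-net of each
unit ball, chi-square and Gaussian tails at the net points and a union bound make `A` bounded below
by 0.8 on all the subspaces and nearly orthogonal to `η` there; this costs `m ≳ d log n`. An upper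
bound for `A` is needed at one further vector only, the error of the best approximation.

The rest is deterministic (`error_le_of_isometry_bounds`): expanding `‖Ah - η‖²` cancels `‖η‖²`, and
near orthogonality controls the cross term. The triangle inequality alone would give 5/2 rather than
3/2 before `‖η‖`. For `n ≤ 1` the logarithm vanishes and `m` is unconstrained, so those cases are
treated directly. -/

namespace DeepDecoder

/-! ### Gaussian concentration -/

/-- A linear combination of i.i.d. centered Gaussians is a centered Gaussian. -/
theorem map_sum_mul_pi_gaussianReal {ι : Type*} [Fintype ι] (v : ℝ≥0) (x : ι → ℝ) :
    (Measure.pi fun _ : ι => gaussianReal 0 v).map (fun a => ∑ j, a j * x j) =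
      gaussianReal 0 (v * ∑ j, ‖x j‖₊ ^ 2) := by
  have hmeas : Measurable fun a : ι → ℝ => ∑ j, a j * x j := by fun_prop
  have : IsProbabilityMeasure
      ((Measure.pi fun _ : ι => gaussianReal 0 v).map (fun a => ∑ j, a j * x j)) :=
    Measure.isProbabilityMeasure_map hmeas.aemeasurable
  refine Measure.ext_of_charFun (funext fun t => ?_)
  rw [charFun_gaussianReal, charFun_apply_real, integral_map hmeas.aemeasurable (by fun_prop)]
  -- Independence: the characteristic function of the sum factors over the coordinates.
  have h1 : ∀ a : ι → ℝ, Complex.exp (t * ((∑ j, a j * x j : ℝ) : ℂ) * Complex.I) =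
      ∏ j, Complex.exp (((t * x j : ℝ) : ℂ) * (a j : ℂ) * Complex.I) := by
    intro a
    rw [← Complex.exp_sum]
    congr 1
    push_cast
    rw [Finset.mul_sum, Finset.sum_mul]
    exact Finset.sum_congr rfl fun j _ => by ring
  simp_rw [h1]
  rw [integral_fintype_prod_eq_prod
    (fun j (z : ℝ) => Complex.exp (((t * x j : ℝ) : ℂ) * (z : ℂ) * Complex.I))]
  simp_rw [← charFun_apply_real, charFun_gaussianReal]
  rw [← Complex.exp_sum]
  congr 1
  have h2 : ∀ j, ((‖x j‖ : ℝ) : ℂ) ^ 2 = (x j : ℂ) ^ 2 := by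
    intro j
    rw [← Complex.ofReal_pow, Real.norm_eq_abs, sq_abs, Complex.ofReal_pow]
  push_cast
  simp only [h2, mul_zero, zero_mul, zero_sub, Finset.mul_sum, Finset.sum_mul, Finset.sum_div,
    ← Finset.sum_neg_distrib]
  exact Finset.sum_congr rfl fun j _ => by ring

theorem integrable_exp_mul_sq_gaussianReal {w : ℝ≥0} (hw : w ≠ 0) {s : ℝ} (hs : 2 * s * w < 1) :
    Integrable (fun z : ℝ => Real.exp (s * z ^ 2)) (gaussianReal 0 w) := by
  have hw' : (0 : ℝ) < w := by positivity
  rw [gaussianReal_of_var_ne_zero 0 hw,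
    integrable_withDensity_iff_integrable_smul' (measurable_gaussianPDF 0 w)
      (Filter.Eventually.of_forall fun _ => gaussianPDF_lt_top)]
  have hb : 0 < 1 / (2 * (w : ℝ)) - s := by
    rw [sub_pos, lt_div_iff₀ (by positivity)]; linarith
  refine ((integrable_exp_neg_mul_sq hb).const_mul (√(2 * Real.pi * w))⁻¹).congr
    (Filter.Eventually.of_forall fun z => ?_)
  simp only [toReal_gaussianPDF, gaussianPDFReal, smul_eq_mul, sub_zero, mul_assoc, ← Real.exp_add]
  congr 2
  field_simp
  ring

theorem integral_exp_mul_sq_gaussianReal {w : ℝ≥0} (hw : w ≠ 0) {s : ℝ} (hs : 2 * s * w < 1) :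
    ∫ z, Real.exp (s * z ^ 2) ∂gaussianReal 0 w = (√(1 - 2 * s * w))⁻¹ := by
  have hw' : (0 : ℝ) < w := by positivity
  rw [integral_gaussianReal_eq_integral_smul hw]
  have h : ∀ z : ℝ, gaussianPDFReal 0 w z • Real.exp (s * z ^ 2) =
      (√(2 * Real.pi * w))⁻¹ * Real.exp (-(1 / (2 * (w : ℝ)) - s) * z ^ 2) := by
    intro z
    simp only [gaussianPDFReal, smul_eq_mul, sub_zero, mul_assoc, ← Real.exp_add]
    congr 2
    field_simp
    ring
  simp_rw [h]
  rw [integral_const_mul, integral_gaussian, ← Real.sqrt_inv, ← Real.sqrt_mul (by positivity),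
    ← Real.sqrt_inv]
  congr 1
  have : 1 - 2 * s * (w : ℝ) ≠ 0 := by linarith
  have h3 : 1 / (2 * (w : ℝ)) - s = (1 - 2 * s * w) / (2 * w) := by field_simp
  rw [h3]
  field_simp

theorem integrable_exp_mul_sum_sq_pi_gaussianReal (m : ℕ) {w : ℝ≥0} (hw : w ≠ 0) {s : ℝ}
    (hs : 2 * s * w < 1) :
    Integrable (fun z : Fin m → ℝ => Real.exp (s * ∑ i, z i ^ 2))
      (Measure.pi fun _ => gaussianReal 0 w) := by
  simp_rw [Finset.mul_sum, Real.exp_sum]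
  exact Integrable.fintype_prod fun _ => integrable_exp_mul_sq_gaussianReal hw hs

theorem mgf_sum_sq_pi_gaussianReal (m : ℕ) {w : ℝ≥0} (hw : w ≠ 0) {s : ℝ} (hs : 2 * s * w < 1) :
    mgf (fun z : Fin m → ℝ => ∑ i, z i ^ 2) (Measure.pi fun _ => gaussianReal 0 w) s =
      Real.exp (-(m / 2 * Real.log (1 - 2 * s * w))) := by
  unfold mgf
  simp_rw [Finset.mul_sum, Real.exp_sum]
  rw [integral_fintype_prod_eq_prod (fun _ (z : ℝ) => Real.exp (s * z ^ 2))]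
  simp_rw [integral_exp_mul_sq_gaussianReal hw hs]
  rw [Finset.prod_const, Finset.card_univ, Fintype.card_fin, Real.sqrt_eq_rpow,
    ← Real.rpow_neg (by linarith), ← Real.rpow_natCast, ← Real.rpow_mul (by linarith),
    Real.rpow_def_of_pos (by linarith)]
  congr 1
  ring

/-- Upper tail of a scaled chi-square variable. -/
theorem measure_sum_sq_ge_le (m : ℕ) {w : ℝ≥0} (hw : w ≠ 0) :
    (Measure.pi fun _ : Fin m => gaussianReal 0 w).real {z | 1.21 * (m * w) ≤ ∑ i, z i ^ 2} ≤
      Real.exp (-(m / 250)) := by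
  have hw' : (0 : ℝ) < w := by positivity
  -- Chernoff at `t = 0.05 / w`; the threshold is `1.21 = 1.1²`. The exponent is at most `(-0.0605 +
  -- 1/18) m`, which is below `-m/250`.
  have hs : 2 * (0.05 / (w : ℝ)) * w = 0.1 := by field_simp; norm_num
  have hs' : 2 * (0.05 / (w : ℝ)) * w < 1 := by rw [hs]; norm_num
  refine (measure_ge_le_exp_mul_mgf (1.21 * (m * w)) (t := 0.05 / w) (by positivity)
    (integrable_exp_mul_sum_sq_pi_gaussianReal m hw hs')).trans ?_
  rw [mgf_sum_sq_pi_gaussianReal m hw hs', hs, ← Real.exp_add]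
  refine Real.exp_le_exp.2 ?_
  have h1 : -(0.05 / (w : ℝ)) * (1.21 * (m * w)) = -0.0605 * m := by field_simp; ring
  have h2 : -Real.log (1 - 0.1) ≤ 1 / 9 := by
    rw [← Real.log_inv]
    exact (Real.log_le_sub_one_of_pos (by norm_num)).trans (by norm_num)
  rw [h1]
  nlinarith [mul_le_mul_of_nonneg_left h2 (Nat.cast_nonneg (α := ℝ) m), Nat.cast_nonneg (α := ℝ) m]

/-- Lower tail of a scaled chi-square variable. -/
theorem measure_sum_sq_le_le (m : ℕ) {w : ℝ≥0} (hw : w ≠ 0) :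
    (Measure.pi fun _ : Fin m => gaussianReal 0 w).real {z | ∑ i, z i ^ 2 ≤ 0.81 * (m * w)} ≤
      Real.exp (-(m / 250)) := by
  have hw' : (0 : ℝ) < w := by positivity
  -- Here `0.81 = 0.9²`, and the exponent is at most `(0.0405 - 0.0475) m`.
  have hs : 2 * (-0.05 / (w : ℝ)) * w = -0.1 := by field_simp; norm_num
  have hs' : 2 * (-0.05 / (w : ℝ)) * w < 1 := by rw [hs]; norm_num
  refine (measure_le_le_exp_mul_mgf (0.81 * (m * w)) (t := -0.05 / w)
    (div_nonpos_of_nonpos_of_nonneg (by norm_num) hw'.le)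
    (integrable_exp_mul_sum_sq_pi_gaussianReal m hw hs')).trans ?_
  rw [mgf_sum_sq_pi_gaussianReal m hw hs', hs, ← Real.exp_add]
  refine Real.exp_le_exp.2 ?_
  have h1 : -(-0.05 / (w : ℝ)) * (0.81 * (m * w)) = 0.0405 * m := by field_simp; ring
  have h2 : 0.095 ≤ Real.log (1 - -0.1) := by
    have := Real.le_log_one_add_of_nonneg (x := 0.1) (by norm_num)
    rw [sub_neg_eq_add]
    exact le_trans (by norm_num) this
  rw [h1]
  nlinarith [mul_le_mul_of_nonneg_left h2 (Nat.cast_nonneg (α := ℝ) m), Nat.cast_nonneg (α := ℝ) m]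

/-- Two-sided tail of a centered Gaussian. -/
theorem gaussianReal_abs_ge_le (w : ℝ≥0) {r : ℝ} (hr : 0 ≤ r) :
    (gaussianReal 0 w).real {z | r ≤ |z|} ≤ 2 * Real.exp (-r ^ 2 / (2 * w)) := by
  have hsub : HasSubgaussianMGF (fun z : ℝ => z) w (gaussianReal 0 w) :=
    ⟨fun t => integrable_exp_mul_gaussianReal t, fun t => by
      rw [mgf_gaussianReal (μ := 0) (v := w) (by simp)]; simp⟩
  have h1 := hsub.measure_ge_le hr
  have h2 := hsub.neg.measure_ge_le hr
  have h3 : {z : ℝ | r ≤ |z|} = {z | r ≤ z} ∪ {z | r ≤ (-fun z : ℝ => z) z} := by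
    ext z; simp [le_abs]
  rw [h3]
  refine (measureReal_union_le _ _).trans ?_
  linarith

variable {m n : ℕ}

instance : IsProbabilityMeasure (gaussianMatrixLaw m n) := by
  unfold gaussianMatrixLaw; infer_instance

theorem toEuclideanLin_of_apply (a : Fin m → Fin n → ℝ) (x : EuclideanSpace ℝ (Fin n))
    (i : Fin m) : Matrix.toEuclideanLin (Matrix.of a) x i = ∑ j, a i j * x j := by
  rfl

theorem measurable_toEuclideanLin_of (x : EuclideanSpace ℝ (Fin n)) :
    Measurable fun a : Fin m → Fin n → ℝ => Matrix.toEuclideanLin (Matrix.of a) x := by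
  have : (fun a : Fin m → Fin n → ℝ => Matrix.toEuclideanLin (Matrix.of a) x) =
      fun a => WithLp.toLp 2 fun i => ∑ j, a i j * x j := rfl
  rw [this]
  fun_prop

theorem sum_nnnorm_sq (x : EuclideanSpace ℝ (Fin n)) : ∑ j, ‖x j‖₊ ^ 2 = ‖x‖₊ ^ 2 := by
  rw [EuclideanSpace.nnnorm_eq, NNReal.sq_sqrt]

/-- The law of `A x` for a Gaussian matrix `A`. -/
theorem map_mulVec_gaussianMatrixLaw (x : EuclideanSpace ℝ (Fin n)) :
    (gaussianMatrixLaw m n).map (fun a i => ∑ j, a i j * x j) =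
      Measure.pi fun _ : Fin m => gaussianReal 0 (1 / (m : ℝ≥0) * ‖x‖₊ ^ 2) := by
  unfold gaussianMatrixLaw
  have h := map_sum_mul_pi_gaussianReal (1 / (m : ℝ≥0)) (fun j => x j)
  rw [sum_nnnorm_sq] at h
  have hm : Measurable fun b : Fin n → ℝ => ∑ j, b j * x j := by fun_prop
  have : ∀ i : Fin m, SigmaFinite ((Measure.pi fun _ : Fin n => gaussianReal 0 (1 / (m : ℝ≥0))).map
      (fun b => ∑ j, b j * x j)) := fun i => by rw [h]; infer_instance
  rw [Measure.pi_map_pi (f := fun _ (b : Fin n → ℝ) => ∑ j, b j * x j)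
    (fun _ => hm.aemeasurable), h]

theorem map_inner_gaussianMatrixLaw (x : EuclideanSpace ℝ (Fin n))
    (η : EuclideanSpace ℝ (Fin m)) :
    (gaussianMatrixLaw m n).map (fun a => inner ℝ (Matrix.toEuclideanLin (Matrix.of a) x) η) =
      gaussianReal 0 (1 / (m : ℝ≥0) * ‖x‖₊ ^ 2 * ‖η‖₊ ^ 2) := by
  have h := map_sum_mul_pi_gaussianReal (1 / (m : ℝ≥0) * ‖x‖₊ ^ 2) (fun i => η i)
  rw [sum_nnnorm_sq, ← map_mulVec_gaussianMatrixLaw x, Measure.map_map] at h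
  · rw [← h]
    congr 1
    ext a
    simp [PiLp.inner_apply, toEuclideanLin_of_apply, mul_comm]
  · fun_prop
  · fun_prop

theorem norm_toEuclideanLin_sq (a : Fin m → Fin n → ℝ) (x : EuclideanSpace ℝ (Fin n)) :
    ‖Matrix.toEuclideanLin (Matrix.of a) x‖ ^ 2 = ∑ i, (∑ j, a i j * x j) ^ 2 := by
  rw [EuclideanSpace.norm_sq_eq]
  simp [toEuclideanLin_of_apply]

theorem gaussianMatrixLaw_norm_gt_le (hm : m ≠ 0) (x : EuclideanSpace ℝ (Fin n)) :
    (gaussianMatrixLaw m n).real {a | 1.1 * ‖x‖ < ‖Matrix.toEuclideanLin (Matrix.of a) x‖} ≤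
      Real.exp (-(m / 250)) := by
  -- At `x = 0` the strict inequality is never met; otherwise the variance is nonzero, as the tail
  -- bound requires.
  rcases eq_or_ne x 0 with rfl | hx
  · simp [Real.exp_nonneg]
  have hw : 1 / (m : ℝ≥0) * ‖x‖₊ ^ 2 ≠ 0 := by
    have : ‖x‖₊ ≠ 0 := by simpa using hx
    positivity
  refine le_trans ?_ (measure_sum_sq_ge_le m hw)
  rw [← map_mulVec_gaussianMatrixLaw x, map_measureReal_apply (by fun_prop)
    (measurableSet_le (by fun_prop) (by fun_prop))]
  refine measureReal_mono fun a ha => ?_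
  have hm' : (m : ℝ) ≠ 0 := by exact_mod_cast hm
  have h1 : (1.1 * ‖x‖) ^ 2 ≤ ‖Matrix.toEuclideanLin (Matrix.of a) x‖ ^ 2 :=
    pow_le_pow_left₀ (by positivity) (le_of_lt ha) 2
  rw [norm_toEuclideanLin_sq] at h1
  refine le_trans (le_of_eq ?_) h1
  push_cast
  field_simp
  norm_num

theorem gaussianMatrixLaw_norm_lt_le (hm : m ≠ 0) (x : EuclideanSpace ℝ (Fin n)) :
    (gaussianMatrixLaw m n).real {a | ‖Matrix.toEuclideanLin (Matrix.of a) x‖ < 0.9 * ‖x‖} ≤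
      Real.exp (-(m / 250)) := by
  rcases eq_or_ne x 0 with rfl | hx
  · simp [Real.exp_nonneg]
  have hw : 1 / (m : ℝ≥0) * ‖x‖₊ ^ 2 ≠ 0 := by
    have : ‖x‖₊ ≠ 0 := by simpa using hx
    positivity
  refine le_trans ?_ (measure_sum_sq_le_le m hw)
  rw [← map_mulVec_gaussianMatrixLaw x, map_measureReal_apply (by fun_prop)
    (measurableSet_le (by fun_prop) (by fun_prop))]
  refine measureReal_mono fun a ha => ?_
  have hm' : (m : ℝ) ≠ 0 := by exact_mod_cast hm
  have h1 : ‖Matrix.toEuclideanLin (Matrix.of a) x‖ ^ 2 ≤ (0.9 * ‖x‖) ^ 2 :=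
    pow_le_pow_left₀ (by positivity) (le_of_lt ha) 2
  rw [norm_toEuclideanLin_sq] at h1
  refine le_trans h1 (le_of_eq ?_)
  push_cast
  field_simp
  norm_num

theorem gaussianMatrixLaw_inner_gt_le (hm : m ≠ 0) (x : EuclideanSpace ℝ (Fin n))
    (η : EuclideanSpace ℝ (Fin m)) :
    (gaussianMatrixLaw m n).real
        {a | 0.1 * (‖x‖ * ‖η‖) < |inner ℝ (Matrix.toEuclideanLin (Matrix.of a) x) η|} ≤
      2 * Real.exp (-(m / 250)) := by
  rcases eq_or_ne x 0 with rfl | hx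
  · simp [Real.exp_nonneg]
  rcases eq_or_ne η 0 with rfl | hη
  · simp [Real.exp_nonneg]
  have hx' : ‖x‖ ≠ 0 := by simpa using hx
  have hη' : ‖η‖ ≠ 0 := by simpa using hη
  have hm' : (m : ℝ) ≠ 0 := by exact_mod_cast hm
  have hmeas : Measurable fun a : Fin m → Fin n → ℝ =>
      inner ℝ (Matrix.toEuclideanLin (Matrix.of a) x) η :=
    (measurable_toEuclideanLin_of x).inner measurable_const
  have h := gaussianReal_abs_ge_le (1 / (m : ℝ≥0) * ‖x‖₊ ^ 2 * ‖η‖₊ ^ 2)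
    (r := 0.1 * (‖x‖ * ‖η‖)) (by positivity)
  rw [← map_inner_gaussianMatrixLaw x η, map_measureReal_apply hmeas
    (measurableSet_le (by fun_prop) (by fun_prop))] at h
  have hsub : {a : Fin m → Fin n → ℝ |
      0.1 * (‖x‖ * ‖η‖) < |inner ℝ (Matrix.toEuclideanLin (Matrix.of a) x) η|} ⊆
      (fun a => inner ℝ (Matrix.toEuclideanLin (Matrix.of a) x) η) ⁻¹'
        {z : ℝ | 0.1 * (‖x‖ * ‖η‖) ≤ |z|} :=
    fun a ha => Set.mem_preimage.2 (Set.mem_ofPred.2 (le_of_lt (Set.mem_ofPred.1 ha)))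
  refine (measureReal_mono hsub).trans (h.trans ?_)
  gcongr
  push_cast
  have : -(0.1 * (‖x‖ * ‖η‖)) ^ 2 / (2 * (1 / (m : ℝ) * ‖x‖ ^ 2 * ‖η‖ ^ 2)) = -(m / 200) := by
    field_simp
    norm_num
  rw [this]
  have : (0 : ℝ) ≤ m := Nat.cast_nonneg m
  linarith

/-! ### Nets of unit balls -/

section Net

variable {E : Type*} [NormedAddCommGroup E] [NormedSpace ℝ E] [FiniteDimensional ℝ E]

/-- If no such set existed, points could be added greedily to a 1-separated subset of the ball of
radius 2 until it exceeded the volumetric bound `5 ^ finrank`. -/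
theorem exists_finset_norm_sub_lt_one :
    ∃ s : Finset E, s.card ≤ 5 ^ Module.finrank ℝ E ∧
      ∀ x : E, ‖x‖ ≤ 2 → ∃ c ∈ s, ‖x - c‖ < 1 := by
  classical
  by_contra! hcon
  have key : ∀ N : ℕ, N ≤ 5 ^ Module.finrank ℝ E + 1 → ∃ s : Finset E, s.card = N ∧
      (∀ c ∈ s, ‖c‖ ≤ 2) ∧ ∀ c ∈ s, ∀ d ∈ s, c ≠ d → 1 ≤ ‖c - d‖ := by
    intro N
    induction N with
    | zero => exact fun _ => ⟨∅, by simp⟩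
    | succ N ih =>
      intro hN
      obtain ⟨s, hs, h2, h1⟩ := ih (by omega)
      obtain ⟨x, hx2, hx1⟩ := hcon s (by omega)
      have hxs : x ∉ s := fun hx => by
        have := hx1 x hx
        norm_num at this
      refine ⟨insert x s, by rw [Finset.card_insert_of_notMem hxs, hs], ?_, ?_⟩
      · simpa using ⟨hx2, h2⟩
      · intro c hc d hd hcd
        rcases Finset.mem_insert.1 hc with rfl | hc' <;>
          rcases Finset.mem_insert.1 hd with rfl | hd'
        · exact absurd rfl hcd
        · exact hx1 d hd'
        · rw [norm_sub_rev]; exact hx1 c hc'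
        · exact h1 c hc' d hd' hcd
  obtain ⟨s, hs, h2, h1⟩ := key _ le_rfl
  have := Besicovitch.card_le_of_separated s h2 h1
  omega

/-- Successive refinement: the remainder `x - c`, rescaled to the ball of radius 2, is approximated
again. Each halving of the scale costs a factor `5 ^ finrank`. -/
theorem exists_finset_norm_sub_le_inv_two_pow (j : ℕ) :
    ∃ s : Finset E, s.card ≤ (5 ^ Module.finrank ℝ E) ^ j ∧
      ∀ x : E, ‖x‖ ≤ 1 → ∃ c ∈ s, ‖x - c‖ ≤ (2 ^ j : ℝ)⁻¹ := by
  classical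
  induction j with
  | zero => exact ⟨{0}, by simp⟩
  | succ j ih =>
    obtain ⟨s, hs, hs'⟩ := ih
    obtain ⟨t, ht, ht'⟩ := exists_finset_norm_sub_lt_one (E := E)
    refine ⟨Finset.image₂ (fun c y => c + (2 ^ (j + 1) : ℝ)⁻¹ • y) s t, ?_, fun x hx => ?_⟩
    · rw [pow_succ]
      exact (Finset.card_image₂_le _ _ _).trans (Nat.mul_le_mul hs ht)
    · obtain ⟨c, hc, hxc⟩ := hs' x hx
      have h2 : ‖(2 ^ (j + 1) : ℝ) • (x - c)‖ ≤ 2 := by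
        rw [norm_smul, Real.norm_of_nonneg (by positivity)]
        calc (2 ^ (j + 1) : ℝ) * ‖x - c‖ ≤ 2 ^ (j + 1) * (2 ^ j)⁻¹ := by gcongr
          _ = 2 := by field_simp; ring
      obtain ⟨y, hy, hxy⟩ := ht' _ h2
      refine ⟨_, Finset.mem_image₂_of_mem hc hy, ?_⟩
      have h3 : x - (c + (2 ^ (j + 1) : ℝ)⁻¹ • y) =
          (2 ^ (j + 1) : ℝ)⁻¹ • ((2 ^ (j + 1) : ℝ) • (x - c) - y) := by
        rw [smul_sub, smul_smul, inv_mul_cancel₀ (by positivity), one_smul]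
        abel
      rw [h3, norm_smul, norm_inv, Real.norm_of_nonneg (by positivity : (0 : ℝ) ≤ 2 ^ (j + 1))]
      exact mul_le_of_le_one_right (by positivity) hxy.le

variable {F : Type*} [NormedAddCommGroup F] [NormedSpace ℝ F]

/-- An upper bound for a linear map on a net of the unit ball extends to the whole space. -/
theorem norm_le_of_forall_net {s : Finset E} (hs : ∀ x : E, ‖x‖ ≤ 1 → ∃ c ∈ s, ‖x - c‖ ≤ 1 / 32)
    (f : E →ₗ[ℝ] F) {b : ℝ} (hb : 0 ≤ b) (hf : ∀ c ∈ s, ‖f c‖ ≤ b * ‖c‖) (x : E) :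
    ‖f x‖ ≤ 33 / 31 * b * ‖x‖ := by
  set g : E →L[ℝ] F := LinearMap.toContinuousLinearMap f with hg
  have hgf : ∀ x, g x = f x := fun _ => rfl
  -- The operator norm bounds itself: a net point has norm at most 33/32 and the remainder
  -- contributes `‖g‖ / 32`. Solving for `‖g‖` gives `33/31 * b`.
  have key : ‖g‖ ≤ b * (33 / 32) + ‖g‖ * (1 / 32) := by
    refine ContinuousLinearMap.opNorm_le_of_unit_norm (by positivity) fun x hx => ?_
    obtain ⟨c, hc, hxc⟩ := hs x hx.le
    have h1 : ‖c‖ ≤ 33 / 32 := by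
      have := norm_sub_norm_le c x
      rw [norm_sub_rev] at this
      linarith
    have h2 : g x = g c + g (x - c) := by rw [map_sub]; abel
    rw [h2]
    refine (norm_add_le _ _).trans (add_le_add ((hf c hc).trans ?_) ((g.le_opNorm _).trans ?_))
    · gcongr
    · gcongr
  rw [← hgf]
  refine (g.le_opNorm x).trans ?_
  gcongr
  linarith

/-- Two-sided bounds for a linear map on a net of the unit ball give a lower bound on the whole
space. -/
theorem le_norm_of_forall_net {s : Finset E} (hs : ∀ x : E, ‖x‖ ≤ 1 → ∃ c ∈ s, ‖x - c‖ ≤ 1 / 32)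
    (f : E →ₗ[ℝ] F) (hf : ∀ c ∈ s, ‖f c‖ ≤ 1.1 * ‖c‖) (hf' : ∀ c ∈ s, 0.9 * ‖c‖ ≤ ‖f c‖) (x : E) :
    0.8 * ‖x‖ ≤ ‖f x‖ := by
  have key : ∀ x : E, ‖x‖ = 1 → 0.8 ≤ ‖f x‖ := by
    intro x hx
    obtain ⟨c, hc, hxc⟩ := hs x hx.le
    have h1 : 31 / 32 ≤ ‖c‖ := by
      have := norm_sub_norm_le x c
      linarith
    have h2 := norm_le_of_forall_net hs f (by norm_num) hf (x - c)
    have h3 := hf' c hc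
    have h4 : ‖f c‖ ≤ ‖f x‖ + ‖f (x - c)‖ := by
      have : f c = f x - f (x - c) := by rw [map_sub]; abel
      rw [this]
      exact norm_sub_le _ _
    -- Numerically, `0.9 * 31/32 - 33/31 * 1.1 / 32 > 0.8`.
    linarith
  rcases eq_or_ne x 0 with rfl | hx
  · simp
  have hx' : ‖x‖ ≠ 0 := by simpa using hx
  have h := key (‖x‖⁻¹ • x) (by rw [norm_smul, norm_inv, norm_norm, inv_mul_cancel₀ hx'])
  rw [map_smul, norm_smul, norm_inv, norm_norm] at h
  have h5 := mul_le_mul_of_nonneg_right h (norm_nonneg x)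
  calc 0.8 * ‖x‖ ≤ ‖x‖⁻¹ * ‖f x‖ * ‖x‖ := h5
    _ = ‖f x‖ := by field_simp

end Net

/-! ### Sign patterns of linear maps -/

section SignPattern

open Finset

variable {E : Type*} [AddCommGroup E] [Module ℝ E] [FiniteDimensional ℝ E] {n : ℕ}

/-- The set of coordinates in which `v` is positive. -/
noncomputable def posSupport (v : Fin n → ℝ) : Finset (Fin n) := {r | 0 < v r}

open Classical in
/-- The sets of positive coordinates of the vectors in the range of `L`. -/
noncomputable def signPatterns (L : E →ₗ[ℝ] Fin n → ℝ) : Finset (Finset (Fin n)) :=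
  {S | ∃ w, posSupport (L w) = S}

/-- The coordinate functionals indexed by a shattered set are independent. Given a relation with
coefficients `g`, shattering supplies a `w` whose coordinates are positive exactly where `g` is;
every term `g r * L w r` is then nonnegative, and one is positive as soon as some `g r` is. If the
nonzero coefficient is negative, `-g` is used instead. -/
theorem card_le_finrank_of_shatters (L : E →ₗ[ℝ] Fin n → ℝ) {s : Finset (Fin n)}
    (hs : (signPatterns L).Shatters s) : #s ≤ Module.finrank ℝ E := by
  classical
  have hli : LinearIndependent ℝ
      (fun r : s => (LinearMap.proj (r : Fin n) ∘ₗ L : Module.Dual ℝ E)) := by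
    by_contra hdep
    obtain ⟨g, hg, i, hi⟩ := Fintype.not_linearIndependent_iff.1 hdep
    have hg' : ∀ w, ∑ r : s, g r * L w r = 0 := fun w => by
      simpa using LinearMap.congr_fun hg w
    have main : ∀ g : s → ℝ, (∀ w, ∑ r : s, g r * L w r = 0) →
        ∀ i, ¬ 0 < g i := by
      intro g hg i hi
      obtain ⟨u, hu, hsu⟩ := hs (t := (univ.filter fun r => 0 < g r).map (Function.Embedding.subtype _))
        (fun r hr => by
          obtain ⟨r', -, rfl⟩ := Finset.mem_map.1 hr
          exact r'.2)
      obtain ⟨w, rfl⟩ : ∃ w, posSupport (L w) = u := by simpa [signPatterns] using hu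
      have hiff : ∀ r : s, 0 < g r ↔ 0 < L w r := by
        intro r
        have h1 : (r : Fin n) ∈ s ∩ posSupport (L w) ↔ 0 < L w r := by simp [posSupport]
        rw [← h1, hsu]
        simp
      refine absurd (hg w) (ne_of_gt ?_)
      refine Finset.sum_pos' (fun r _ => ?_) ⟨i, mem_univ _, mul_pos hi ((hiff i).1 hi)⟩
      by_cases hr : 0 < g r
      · exact (mul_pos hr ((hiff r).1 hr)).le
      · exact mul_nonneg_of_nonpos_of_nonpos (not_lt.1 hr)
          (not_lt.1 fun h => hr ((hiff r).2 h))
    rcases lt_or_gt_of_ne hi with hi | hi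
    · refine main (-g) (fun w => ?_) i (by simpa using hi)
      simp only [Pi.neg_apply, neg_mul, Finset.sum_neg_distrib, hg', neg_zero]
    · exact main g hg' i hi
  simpa [Subspace.dual_finrank_eq] using hli.fintype_card_le_finrank

theorem sum_choose_le_succ_pow (n p : ℕ) : ∑ i ∈ Iic p, n.choose i ≤ (n + 1) ^ p := by
  rw [add_pow, Nat.range_succ_eq_Iic]
  refine Finset.sum_le_sum fun i hi => ?_
  have := Nat.choose_pos (Finset.mem_Iic.1 hi)
  have h2 := Nat.choose_le_pow n i
  simp only [one_pow, mul_one, Nat.cast_id]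
  exact h2.trans (Nat.le_mul_of_pos_right _ this)

theorem card_signPatterns_le (L : E →ₗ[ℝ] Fin n → ℝ) :
    #(signPatterns L) ≤ (n + 1) ^ Module.finrank ℝ E := by
  have hvc : (signPatterns L).vcDim ≤ Module.finrank ℝ E :=
    Finset.sup_le fun s hs => card_le_finrank_of_shatters L (mem_shatterer.1 hs)
  calc #(signPatterns L) ≤ #(signPatterns L).shatterer := card_le_card_shatterer _
    _ ≤ ∑ i ∈ Iic (signPatterns L).vcDim, (Fintype.card (Fin n)).choose i :=
        card_shatterer_le_sum_vcDim
    _ ≤ (n + 1) ^ (signPatterns L).vcDim := by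
        rw [Fintype.card_fin]; exact sum_choose_le_succ_pow _ _
    _ ≤ (n + 1) ^ Module.finrank ℝ E := Nat.pow_le_pow_right (Nat.succ_pos n) hvc

end SignPattern

/-! ### Recovery for unions of subspaces -/

variable {m n : ℕ} {Θ : Type} {G : Θ → EuclideanSpace ℝ (Fin n)}

theorem residual_sub_eq (A : Matrix (Fin m) (Fin n) ℝ) (xstar x : EuclideanSpace ℝ (Fin n))
    (η : EuclideanSpace ℝ (Fin m)) :
    residual A (Matrix.toEuclideanLin A xstar + η) x =
      ‖Matrix.toEuclideanLin A (x - xstar) - η‖ := by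
  rw [residual, map_sub, ← norm_neg]
  congr 1
  abel

theorem continuous_residual (A : Matrix (Fin m) (Fin n) ℝ) (y : EuclideanSpace ℝ (Fin m)) :
    Continuous (residual A y) := by
  unfold residual
  have : Continuous (Matrix.toEuclideanLin A) := LinearMap.continuous_of_finiteDimensional _
  fun_prop

/-- The range of `G` need not be closed, so a best approximation may exist only in its closure;
continuity of the residual lets the minimizer be compared with it. -/
theorem IsApproxMinimizer.residual_le {A : Matrix (Fin m) (Fin n) ℝ}
    {y : EuclideanSpace ℝ (Fin m)} {ε : ℝ} {Chat : Θ} (h : IsApproxMinimizer G A y ε Chat)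
    {x : EuclideanSpace ℝ (Fin n)} (hx : x ∈ closure (Set.range G)) :
    residual A y (G Chat) ≤ residual A y x + ε := by
  have hclosed : IsClosed {x | residual A y (G Chat) ≤ residual A y x + ε} :=
    isClosed_le continuous_const ((continuous_residual A y).add continuous_const)
  refine hclosed.closure_subset_iff.2 ?_ hx
  rintro _ ⟨C, rfl⟩
  have hbdd : BddBelow (Set.range fun C => residual A y (G C)) :=
    ⟨0, by rintro _ ⟨C, rfl⟩; exact norm_nonneg _⟩
  have := ciInf_le hbdd C
  unfold IsApproxMinimizer at h
  show residual A y (G Chat) ≤ residual A y (G C) + ε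
  linarith

/-- The infimum of the distances to the range is attained on its closure. -/
theorem exists_mem_closure_range_norm_sub_eq [Nonempty Θ] (xstar : EuclideanSpace ℝ (Fin n)) :
    ∃ x ∈ closure (Set.range G), ‖x - xstar‖ = ⨅ C, ‖G C - xstar‖ := by
  have hne : (closure (Set.range G)).Nonempty := (Set.range_nonempty G).closure
  obtain ⟨x, hx, h⟩ := isClosed_closure.exists_infDist_eq_dist hne xstar
  refine ⟨x, hx, ?_⟩
  rw [← dist_eq_norm, dist_comm, ← h, Metric.infDist_closure]
  have hglb := Metric.isGLB_infDist (x := xstar) (Set.range_nonempty G)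
  rw [← Set.range_comp] at hglb
  rw [← hglb.ciInf_eq]
  exact iInf_congr fun C => by rw [Function.comp_apply, dist_comm, dist_eq_norm]

/-- Here `H` is the recovery error, `D` the best approximation error, `e` the noise norm, `a = ‖Ah‖`
and `b = ⟪Ah, η⟫`. With `E = 1.1 D + ε`, cancelling `e²` leaves `0.64 H² ≤ 0.4 He + 2eE + E²`, which
fails once `H > 3/2 e + 2E`. The factor 6 on `D` has slack, since 2.2 comes out. -/
theorem error_le_of_isometry_bounds {H D e ε a b : ℝ} (hH : 0 ≤ H) (hD : 0 ≤ D) (he : 0 ≤ e)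
    (hε : 0 ≤ ε) (hlow : 0.8 * H ≤ a) (hb : |b| ≤ 0.2 * (H * e))
    (h : a ^ 2 - 2 * b + e ^ 2 ≤ (1.1 * D + e + ε) ^ 2) : H ≤ 6 * D + 3 / 2 * e + 2 * ε := by
  have h1 : (0.8 * H) ^ 2 ≤ a ^ 2 := pow_le_pow_left₀ (by positivity) hlow 2
  have h2 := (abs_le.1 hb).2
  set E := 1.1 * D + ε with hE
  have hE0 : 0 ≤ E := by positivity
  suffices H ≤ 3 / 2 * e + 2 * E by rw [hE] at this; linarith
  have h3 : 0.64 * H ^ 2 ≤ 0.4 * (H * e) + 2 * (e * E) + E ^ 2 := by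
    have : 1.1 * D + e + ε = E + e := by rw [hE]; ring
    rw [this] at h
    nlinarith
  by_contra! hlt
  nlinarith [mul_nonneg he hE0, sq_nonneg e, sq_nonneg E,
    mul_pos (lt_of_le_of_lt (by positivity : (0:ℝ) ≤ 3 / 2 * e + 2 * E) hlt) (sub_pos.2 hlt),
    mul_nonneg he (sub_pos.2 hlt).le, mul_nonneg hE0 (sub_pos.2 hlt).le]

/-- A matrix that is well-behaved on the subspaces covering the range recovers the signal. -/
theorem mem_recoveryEvent_of_bounds {ι : Type*}
    {W : ι → Submodule ℝ (EuclideanSpace ℝ (Fin n))}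
    {xstar x₀ : EuclideanSpace ℝ (Fin n)} {η : EuclideanSpace ℝ (Fin m)} {ε : ℝ} (hε : 0 ≤ ε)
    (hG : ∀ C, ∃ i, G C - xstar ∈ W i) (hx₀ : x₀ ∈ closure (Set.range G))
    (hx₀' : ‖x₀ - xstar‖ = ⨅ C, ‖G C - xstar‖) {a : Fin m → Fin n → ℝ}
    (hlow : ∀ i, ∀ h ∈ W i, 0.8 * ‖h‖ ≤ ‖Matrix.toEuclideanLin (Matrix.of a) h‖)
    (hin : ∀ i, ∀ h ∈ W i,
      |inner ℝ (Matrix.toEuclideanLin (Matrix.of a) h) η| ≤ 0.2 * (‖h‖ * ‖η‖))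
    (hup : ‖Matrix.toEuclideanLin (Matrix.of a) (x₀ - xstar)‖ ≤ 1.1 * ‖x₀ - xstar‖) :
    a ∈ recoveryEvent G xstar η ε := by
  intro Chat hC
  obtain ⟨i, hi⟩ := hG Chat
  have h := hC.residual_le hx₀
  rw [residual_sub_eq, residual_sub_eq] at h
  rw [← hx₀']
  refine error_le_of_isometry_bounds (norm_nonneg _) (norm_nonneg _) (norm_nonneg _) hε
    (hlow i _ hi) (hin i _ hi) ?_
  rw [← norm_sub_sq_real]
  refine pow_le_pow_left₀ (norm_nonneg _) (h.trans ?_) 2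
  have := norm_sub_le (Matrix.toEuclideanLin (Matrix.of a) (x₀ - xstar)) η
  linarith

/-- A union of Gaussian tail events over a finite set of vectors. -/
theorem exists_good_event (hm : m ≠ 0) (T : Finset (EuclideanSpace ℝ (Fin n)))
    (v : EuclideanSpace ℝ (Fin n)) (η : EuclideanSpace ℝ (Fin m)) :
    ∃ E : Set (Fin m → Fin n → ℝ), MeasurableSet E ∧
      1 - (4 * T.card + 1) * Real.exp (-(m / 250)) ≤ (gaussianMatrixLaw m n).real E ∧
      ∀ a ∈ E, (∀ x ∈ T, ‖Matrix.toEuclideanLin (Matrix.of a) x‖ ≤ 1.1 * ‖x‖ ∧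
        0.9 * ‖x‖ ≤ ‖Matrix.toEuclideanLin (Matrix.of a) x‖ ∧
        |inner ℝ (Matrix.toEuclideanLin (Matrix.of a) x) η| ≤ 0.1 * (‖x‖ * ‖η‖)) ∧
        ‖Matrix.toEuclideanLin (Matrix.of a) v‖ ≤ 1.1 * ‖v‖ := by
  let up (x : EuclideanSpace ℝ (Fin n)) : Set (Fin m → Fin n → ℝ) :=
    {a | 1.1 * ‖x‖ < ‖Matrix.toEuclideanLin (Matrix.of a) x‖}
  let low (x : EuclideanSpace ℝ (Fin n)) : Set (Fin m → Fin n → ℝ) :=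
    {a | ‖Matrix.toEuclideanLin (Matrix.of a) x‖ < 0.9 * ‖x‖}
  let inn (x : EuclideanSpace ℝ (Fin n)) : Set (Fin m → Fin n → ℝ) :=
    {a | 0.1 * (‖x‖ * ‖η‖) < |inner ℝ (Matrix.toEuclideanLin (Matrix.of a) x) η|}
  have hup : ∀ x, MeasurableSet (up x) := fun x =>
    measurableSet_lt measurable_const (measurable_toEuclideanLin_of x).norm
  have hlow : ∀ x, MeasurableSet (low x) := fun x =>
    measurableSet_lt (measurable_toEuclideanLin_of x).norm measurable_const
  have hinn : ∀ x, MeasurableSet (inn x) := fun x =>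
    measurableSet_lt measurable_const
      (((measurable_toEuclideanLin_of x).inner measurable_const).norm : Measurable fun a =>
        ‖inner ℝ (Matrix.toEuclideanLin (Matrix.of a) x) η‖)
  let bad : Set (Fin m → Fin n → ℝ) := (⋃ x ∈ T, (up x ∪ low x ∪ inn x)) ∪ up v
  have hbad : MeasurableSet bad :=
    (Finset.measurableSet_biUnion _ fun x _ => ((hup x).union (hlow x)).union (hinn x)).union
      (hup v)
  refine ⟨badᶜ, hbad.compl, ?_, fun a ha => ?_⟩
  · rw [probReal_compl_eq_one_sub hbad]
    have h1 : ∀ x, (gaussianMatrixLaw m n).real (up x ∪ low x ∪ inn x) ≤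
        4 * Real.exp (-(m / 250)) := fun x => by
      have h1 := measureReal_union_le (μ := gaussianMatrixLaw m n) (up x ∪ low x) (inn x)
      have h2 := measureReal_union_le (μ := gaussianMatrixLaw m n) (up x) (low x)
      have h3 : (gaussianMatrixLaw m n).real (up x) ≤ _ := gaussianMatrixLaw_norm_gt_le hm x
      have h4 : (gaussianMatrixLaw m n).real (low x) ≤ _ := gaussianMatrixLaw_norm_lt_le hm x
      have h5 : (gaussianMatrixLaw m n).real (inn x) ≤ _ := gaussianMatrixLaw_inner_gt_le hm x η
      linarith
    have h2 : (gaussianMatrixLaw m n).real bad ≤ (4 * T.card + 1) * Real.exp (-(m / 250)) := by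
      refine (measureReal_union_le _ _).trans ?_
      have h3 := (measureReal_biUnion_finset_le (μ := gaussianMatrixLaw m n) T
        fun x => up x ∪ low x ∪ inn x).trans (Finset.sum_le_sum fun x _ => h1 x)
      rw [Finset.sum_const, nsmul_eq_mul] at h3
      have h4 : (gaussianMatrixLaw m n).real (up v) ≤ _ := gaussianMatrixLaw_norm_gt_le hm v
      linarith
    linarith
  · simp only [bad, up, low, inn, Set.mem_compl_iff, Set.mem_union, Set.mem_iUnion,
      Set.mem_ofPred_eq, not_or, not_exists, not_lt] at ha
    exact ⟨fun x hx => ⟨(ha.1 x hx).1.1, (ha.1 x hx).1.2, (ha.1 x hx).2⟩, ha.2⟩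

theorem exists_finset_net_submodule (W : Submodule ℝ (EuclideanSpace ℝ (Fin n))) {d : ℕ}
    (hd : Module.finrank ℝ W ≤ d) :
    ∃ s : Finset W, s.card ≤ 3125 ^ d ∧ ∀ x : W, ‖x‖ ≤ 1 → ∃ c ∈ s, ‖x - c‖ ≤ 1 / 32 := by
  -- Five halvings: `2⁻⁵ = 1/32` and `5⁵ = 3125`.
  obtain ⟨s, hs, h⟩ := exists_finset_norm_sub_le_inv_two_pow (E := W) 5
  refine ⟨s, hs.trans ?_, fun x hx => ?_⟩
  · rw [← pow_mul, mul_comm, pow_mul]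
    exact Nat.pow_le_pow_right (by norm_num) hd
  · obtain ⟨c, hc, h⟩ := h x hx
    exact ⟨c, hc, h.trans (by norm_num)⟩

/-- Since `n ≥ 2`, all constants are absorbed into powers of `n`: `8 ≤ n³`, `n + 1 ≤ n²`, `3125 ≤
n¹²`. The total exponent `14d + 15` is at most `29d`, and `29/20000 - 1/250 < -1/1000`. -/
theorem union_bound_le {d N : ℕ} (hn : 2 ≤ n) (hd : 1 ≤ d)
    (hN : N ≤ (n + 1) ^ d * 3125 ^ (d + 1)) (hm : 20000 * (d * Real.log n) ≤ m) :
    (4 * N + 1) * Real.exp (-(m / 250)) ≤ Real.exp (-(1 / 1000 * m)) := by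
  have h1 : 4 * N + 1 ≤ n ^ (29 * d) := by
    have h3 : 1 ≤ (n + 1) ^ d * 3125 ^ (d + 1) := Nat.one_le_iff_ne_zero.2 (by positivity)
    calc 4 * N + 1 ≤ 2 ^ 3 * ((n + 1) ^ d * 3125 ^ (d + 1)) := by omega
      _ ≤ n ^ 3 * ((n ^ 2) ^ d * (n ^ 12) ^ (d + 1)) := by
          gcongr
          · nlinarith
          · exact le_trans (by norm_num) (Nat.pow_le_pow_left hn 12)
      _ = n ^ (3 + (2 * d + 12 * (d + 1))) := by rw [← pow_mul, ← pow_mul, ← pow_add, ← pow_add]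
      _ ≤ n ^ (29 * d) := Nat.pow_le_pow_right (by omega) (by omega)
  have h2 : ((4 * N + 1 : ℕ) : ℝ) ≤ Real.exp (29 * (d * Real.log n)) := by
    refine (Nat.cast_le.2 h1).trans (le_of_eq ?_)
    have hn0 : (0 : ℝ) < n := by exact_mod_cast (by omega : 0 < n)
    rw [Nat.cast_pow, ← Real.rpow_natCast, Real.rpow_def_of_pos hn0]
    congr 1
    push_cast
    ring
  push_cast at h2
  calc (4 * (N : ℝ) + 1) * Real.exp (-(m / 250))
      ≤ Real.exp (29 * (d * Real.log n)) * Real.exp (-(m / 250)) := by gcongr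
    _ = Real.exp (29 * (d * Real.log n) + -(m / 250)) := (Real.exp_add _ _).symm
    _ ≤ Real.exp (-(1 / 1000 * m)) := by
        refine Real.exp_le_exp.2 ?_
        have : (0 : ℝ) ≤ m := Nat.cast_nonneg m
        linarith

/-- Recovery for a generator whose range is covered by at most `(n + 1) ^ d` subspaces of
dimension at most `d`. -/
theorem recoversWithHighProb_of_union_submodules [Nonempty Θ] {ι : Type*} [Fintype ι]
    (V : ι → Submodule ℝ (EuclideanSpace ℝ (Fin n))) (hG : ∀ C, ∃ i, G C ∈ V i) {d : ℕ}
    (hn : 2 ≤ n) (hd : 1 ≤ d) (hV : ∀ i, Module.finrank ℝ (V i) ≤ d)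
    (hι : Fintype.card ι ≤ (n + 1) ^ d) (hm : 20000 * (d * Real.log n) ≤ m) :
    RecoversWithHighProb m (1 / 1000) G := by
  classical
  intro xstar η ε hε
  have hm0 : m ≠ 0 := by
    rintro rfl
    have h1 : 0 < Real.log n := Real.log_pos (by exact_mod_cast (by omega : 1 < n))
    have h2 : (0 : ℝ) < d := by exact_mod_cast hd
    have := mul_pos h2 h1
    norm_num at hm
    linarith
  -- Adjoining `x*` puts every difference `G C - x*` in some `W i`, at the cost of one dimension.
  let W (i : ι) : Submodule ℝ (EuclideanSpace ℝ (Fin n)) := V i ⊔ Submodule.span ℝ {xstar}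
  have hW : ∀ i, Module.finrank ℝ (W i) ≤ d + 1 := fun i =>
    (Submodule.finrank_add_le_finrank_add_finrank _ _).trans
      (add_le_add (hV i) ((finrank_span_le_card _).trans (by simp)))
  choose s hs hs' using fun i => exists_finset_net_submodule (W i) (hW i)
  let T : Finset (EuclideanSpace ℝ (Fin n)) :=
    Finset.univ.biUnion fun i => (s i).image Subtype.val
  have hT : T.card ≤ (n + 1) ^ d * 3125 ^ (d + 1) := by
    refine (Finset.card_biUnion_le_card_mul _ _ (3125 ^ (d + 1))
      fun i _ => Finset.card_image_le.trans (hs i)).trans ?_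
    rw [Finset.card_univ]
    gcongr
  have hmem : ∀ i, ∀ c ∈ s i, (c : EuclideanSpace ℝ (Fin n)) ∈ T := fun i c hc =>
    Finset.mem_biUnion.2 ⟨i, Finset.mem_univ _, Finset.mem_image_of_mem _ hc⟩
  obtain ⟨x₀, hx₀, hx₀'⟩ := exists_mem_closure_range_norm_sub_eq (G := G) xstar
  obtain ⟨E, hE, hprob, hgood⟩ := exists_good_event hm0 T (x₀ - xstar) η
  refine ⟨E, hE, fun a ha => ?_, ?_⟩
  · obtain ⟨hTa, hva⟩ := hgood a ha
    let A := Matrix.toEuclideanLin (Matrix.of a)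
    refine mem_recoveryEvent_of_bounds (W := W) hε (fun C => ?_) hx₀ hx₀' (fun i h hh => ?_)
      (fun i h hh => ?_) hva
    · obtain ⟨i, hi⟩ := hG C
      exact ⟨i, Submodule.sub_mem _ (Submodule.mem_sup_left hi)
        (Submodule.mem_sup_right (Submodule.mem_span_singleton_self _))⟩
    · exact le_norm_of_forall_net (hs' i) (A ∘ₗ (W i).subtype)
        (fun c hc => (hTa c (hmem i c hc)).1) (fun c hc => (hTa c (hmem i c hc)).2.1) ⟨h, hh⟩
    -- The net argument also applies to the functional `h ↦ ⟪η, Ah⟫`, and `33/31 * 0.1 ≤ 0.2`.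
    · have := norm_le_of_forall_net (hs' i) ((innerₗ _ η) ∘ₗ A ∘ₗ (W i).subtype)
        (b := 0.1 * ‖η‖) (by positivity) (fun c hc => by
          have := (hTa c (hmem i c hc)).2.2
          rw [real_inner_comm] at this
          refine this.trans (le_of_eq ?_)
          rw [Submodule.coe_norm]; ring) ⟨h, hh⟩
      rw [real_inner_comm]
      refine le_trans this ?_
      rw [Submodule.coe_norm]
      nlinarith [mul_nonneg (norm_nonneg h) (norm_nonneg η)]
  · have := union_bound_le hn hd hT hm
    linarith

/-! ### Degenerate cases -/

variable {m n : ℕ} {Θ : Type} {G : Θ → EuclideanSpace ℝ (Fin n)}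

theorem recoversWithHighProb_of_forall_eq_zero {c : ℝ} (hG : ∀ C, G C = 0) :
    RecoversWithHighProb m c G := by
  intro xstar η ε hε
  refine ⟨Set.univ, MeasurableSet.univ, fun a _ Chat _ => ?_, ?_⟩
  · have : Nonempty Θ := ⟨Chat⟩
    simp only [hG, ciInf_const]
    have := norm_nonneg (0 - xstar)
    have := norm_nonneg η
    linarith
  · rw [probReal_univ]
    have := Real.exp_nonneg (-(c * m))
    linarith

/-- Least squares over a line. -/
theorem abs_le_of_norm_smul_sub_le {F : Type*} [NormedAddCommGroup F] [InnerProductSpace ℝ F]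
    {u η : F} {s ε : ℝ} (hε : 0 ≤ ε) (hu : 0.9 ≤ ‖u‖)
    (h : ∀ t : ℝ, ‖s • u - η‖ ≤ ‖t • u - η‖ + ε) : |s| ≤ 3 / 2 * ‖η‖ + 2 * ε := by
  have hu0 : 0 < ‖u‖ := by linarith
  -- `t` is the least-squares coefficient; by Pythagoras the excess `|s - t| ‖u‖` is controlled by
  -- `ε` and the optimal residual `q`, while `|t| ‖u‖` and `q` are the legs of a right triangle with
  -- hypotenuse `‖η‖`.
  set t := inner ℝ u η / ‖u‖ ^ 2 with ht
  have hort : inner ℝ u (t • u - η) = 0 := by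
    rw [inner_sub_right, inner_smul_right, real_inner_self_eq_norm_sq, ht]
    field_simp
    ring
  set q := ‖t • u - η‖ with hq
  have hq0 : 0 ≤ q := norm_nonneg _
  have hpyth : ∀ r : ℝ, ‖(t + r) • u - η‖ ^ 2 = (|r| * ‖u‖) ^ 2 + q ^ 2 := by
    intro r
    have : (t + r) • u - η = r • u + (t • u - η) := by rw [add_smul]; abel
    rw [this, norm_add_sq_real, inner_smul_left, hort, norm_smul, Real.norm_eq_abs, hq]
    simp
  have h1 := hpyth (s - t)
  have h2 := hpyth (-t)
  rw [add_sub_cancel] at h1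
  rw [add_neg_cancel, zero_smul, zero_sub, norm_neg, abs_neg] at h2
  have h3 : ‖s • u - η‖ ^ 2 ≤ (q + ε) ^ 2 := pow_le_pow_left₀ (norm_nonneg _) (h t) 2
  have h4 : |s - t| * ‖u‖ ≤ 0.4 * q + 1.5 * ε := by
    refine abs_le_of_sq_le_sq' ?_ (by positivity) |>.2
    nlinarith [sq_nonneg (0.4 * q - ε)]
  have h5 : |t| * ‖u‖ + 0.4 * q ≤ 1.1 * ‖η‖ := by
    refine abs_le_of_sq_le_sq' ?_ (by positivity) |>.2
    nlinarith [sq_nonneg (0.4 * (|t| * ‖u‖) - q), sq_nonneg q, sq_nonneg (|t| * ‖u‖)]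
  have h6 : |s| ≤ |t| + |s - t| := by
    have := abs_add_le t (s - t)
    rwa [add_sub_cancel] at this
  have h7 : |s| * ‖u‖ ≤ 1.1 * ‖η‖ + 1.5 * ε := by
    have := mul_le_mul_of_nonneg_right h6 hu0.le
    linarith
  have h8 : |s| * 0.9 ≤ |s| * ‖u‖ := mul_le_mul_of_nonneg_left hu (abs_nonneg s)
  have := norm_nonneg η
  linarith

/-- Recovery of one-dimensional signals by a homogeneous generator. -/
theorem recoversWithHighProb_of_dim_one {G : Θ → EuclideanSpace ℝ (Fin 1)}
    (hG : ∀ C (t : ℝ), ∃ C', G C' = t • G C) : RecoversWithHighProb m (1 / 1000) G := by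
  by_cases h0 : ∀ C, G C = 0
  · exact recoversWithHighProb_of_forall_eq_zero h0
  intro xstar η ε hε
  rcases eq_or_ne m 0 with rfl | hm
  -- For `m = 0` the required probability is `1 - exp 0 = 0`.
  · exact ⟨∅, MeasurableSet.empty, Set.empty_subset _, by simp⟩
  push Not at h0
  obtain ⟨C₀, hC₀⟩ := h0
  set e : EuclideanSpace ℝ (Fin 1) := EuclideanSpace.single 0 1 with he
  have hspan : ∀ x : EuclideanSpace ℝ (Fin 1), x = x 0 • e := by
    intro x
    ext i
    rw [Subsingleton.elim i 0]
    simp [he]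
  have hnorm : ∀ t : ℝ, ‖t • e‖ = |t| := by
    intro t
    simp [he, norm_smul]
  -- A nonzero homogeneous generator reaches all of the line, so recovery is unconstrained least
  -- squares.
  have hsurj : ∀ x, ∃ C, G C = x := by
    intro x
    have h1 : G C₀ 0 ≠ 0 := fun h => hC₀ (by rw [hspan (G C₀), h, zero_smul])
    obtain ⟨C, hC⟩ := hG C₀ (x 0 / G C₀ 0)
    refine ⟨C, ?_⟩
    rw [hC, hspan (G C₀), smul_smul]
    conv_rhs => rw [hspan x]
    congr 1
    simp [he, h1]
  let low : Set (Fin m → Fin 1 → ℝ) := {a | ‖Matrix.toEuclideanLin (Matrix.of a) e‖ < 0.9 * ‖e‖}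
  have hlow : MeasurableSet low :=
    measurableSet_lt (measurable_toEuclideanLin_of e).norm measurable_const
  refine ⟨lowᶜ, hlow.compl, fun a ha Chat hC => ?_, ?_⟩
  · have hu : 0.9 ≤ ‖Matrix.toEuclideanLin (Matrix.of a) e‖ := by
      have h1 : 0.9 * ‖e‖ ≤ ‖Matrix.toEuclideanLin (Matrix.of a) e‖ := not_lt.1 ha
      have h2 := hnorm 1
      rw [one_smul, abs_one] at h2
      rwa [h2, mul_one] at h1
    have hkey := abs_le_of_norm_smul_sub_le (η := η) (s := (G Chat - xstar) 0) hε hu fun t => by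
      obtain ⟨C, hC'⟩ := hsurj (xstar + t • e)
      have h1 := hC.residual_le (subset_closure ⟨C, rfl⟩ : G C ∈ closure (Set.range G))
      rw [residual_sub_eq, residual_sub_eq, hC', add_sub_cancel_left, hspan (G Chat - xstar),
        map_smul, map_smul] at h1
      exact h1
    rw [hspan (G Chat - xstar), hnorm]
    have : 0 ≤ ⨅ C, ‖G C - xstar‖ := Real.iInf_nonneg fun _ => norm_nonneg _
    linarith
  · rw [probReal_compl_eq_one_sub hlow]
    have h1 : (gaussianMatrixLaw m 1).real low ≤ Real.exp (-(m / 250)) :=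
      gaussianMatrixLaw_norm_lt_le hm e
    have h2 : Real.exp (-((m : ℝ) / 250)) ≤ Real.exp (-(1 / 1000 * m)) := by
      refine Real.exp_le_exp.2 ?_
      have : (0 : ℝ) ≤ m := Nat.cast_nonneg m
      linarith
    linarith

/-! ### One ReLU layer -/

section Layer

variable {E : Type} [AddCommGroup E] [Module ℝ E] {k : ℕ}

/-- Channel `i` is the ReLU of a linear image of the parameter `C.1 i`; the output combines the
channels with the weights `C.2`. -/
noncomputable def layer (L : Fin k → E →ₗ[ℝ] Fin n → ℝ) (C : (Fin k → E) × (Fin k → ℝ)) :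
    EuclideanSpace ℝ (Fin n) :=
  WithLp.toLp 2 ((Matrix.of fun r i => max 0 (L i (C.1 i) r)) *ᵥ C.2)

theorem layer_apply (L : Fin k → E →ₗ[ℝ] Fin n → ℝ) (C : (Fin k → E) × (Fin k → ℝ)) (r : Fin n) :
    layer L C r = ∑ i, max 0 (L i (C.1 i) r) * C.2 i := rfl

theorem layer_smul (L : Fin k → E →ₗ[ℝ] Fin n → ℝ) (C : (Fin k → E) × (Fin k → ℝ)) (t : ℝ) :
    layer L (C.1, t • C.2) = t • layer L C := by
  ext r
  simp only [layer_apply, PiLp.smul_apply, Pi.smul_apply, smul_eq_mul, Finset.mul_sum]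
  exact Finset.sum_congr rfl fun i _ => by ring

/-- The linear map obtained from the layer by freezing the activation pattern. -/
noncomputable def frozenLayer (L : Fin k → E →ₗ[ℝ] Fin n → ℝ) (S : Fin k → Finset (Fin n)) :
    (Fin k → E) →ₗ[ℝ] EuclideanSpace ℝ (Fin n) where
  toFun w := WithLp.toLp 2 fun r => ∑ i, if r ∈ S i then L i (w i) r else 0
  map_add' v w := by
    ext r
    simp only [PiLp.add_apply, ← Finset.sum_add_distrib]
    refine Finset.sum_congr rfl fun i _ => ?_
    split_ifs <;> simp
  map_smul' t w := by
    ext r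
    simp only [PiLp.smul_apply, smul_eq_mul, RingHom.id_apply, Finset.mul_sum]
    refine Finset.sum_congr rfl fun i _ => ?_
    split_ifs <;> simp

/-- The pattern is read off from `C.1 i` before scaling, so output weights of either sign can be
absorbed into the parameter. They therefore add nothing to the dimension. -/
theorem layer_eq_frozenLayer (L : Fin k → E →ₗ[ℝ] Fin n → ℝ) (C : (Fin k → E) × (Fin k → ℝ)) :
    layer L C = frozenLayer L (fun i => posSupport (L i (C.1 i))) (fun i => C.2 i • C.1 i) := by
  ext r
  rw [layer_apply]
  refine Finset.sum_congr rfl fun i _ => ?_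
  by_cases h : 0 < L i (C.1 i) r
  · simp [posSupport, h, max_eq_right h.le, mul_comm]
  · simp [posSupport, h, max_eq_left (not_lt.1 h)]

theorem recoversWithHighProb_layer [FiniteDimensional ℝ E] (L : Fin k → E →ₗ[ℝ] Fin n → ℝ)
    (hm : 20000 * ((k * Module.finrank ℝ E : ℕ) * Real.log n) ≤ m) :
    RecoversWithHighProb m (1 / 1000) (layer L) := by
  rcases Nat.eq_zero_or_pos (k * Module.finrank ℝ E) with hd | hd
  · refine recoversWithHighProb_of_forall_eq_zero fun C => ?_
    rcases Nat.mul_eq_zero.1 hd with rfl | hE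
    · ext r; simp [layer_apply]
    · have := Module.finrank_zero_iff.1 hE
      ext r
      rw [layer_apply]
      refine Finset.sum_eq_zero fun i _ => ?_
      rw [Subsingleton.elim (C.1 i) 0, map_zero]
      simp
  -- `Real.log` vanishes at 0 and 1, so `hm` carries no information there.
  obtain rfl | rfl | hn : n = 0 ∨ n = 1 ∨ 2 ≤ n := by omega
  · exact recoversWithHighProb_of_forall_eq_zero fun C => Subsingleton.elim _ _
  · exact recoversWithHighProb_of_dim_one fun C t => ⟨_, layer_smul L C t⟩
  refine recoversWithHighProb_of_union_submodules
    -- One subspace per choice of a realizable pattern in each channel; the count is the product of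
    -- the `k` channel bounds.
    (ι := (i : Fin k) → {S // S ∈ signPatterns (L i)})
    (fun S => LinearMap.range (frozenLayer L fun i => (S i).1)) (fun C => ?_) hn hd (fun S => ?_)
    ?_ hm
  · refine ⟨fun i => ⟨posSupport (L i (C.1 i)), ?_⟩, fun i => C.2 i • C.1 i, ?_⟩
    · simp [signPatterns]
    · exact (layer_eq_frozenLayer L C).symm
  · refine (LinearMap.finrank_range_le _).trans ?_
    rw [Module.finrank_pi_fintype]
    simp
  · rw [Fintype.card_pi]
    simp only [Fintype.card_coe]
    refine (Finset.prod_le_prod' fun i _ => card_signPatterns_le (L i)).trans ?_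
    rw [Finset.prod_const, Finset.card_univ, Fintype.card_fin, ← pow_mul, mul_comm]

end Layer

/-! ### The deep decoder -/

variable {n₁ k l : ℕ}

theorem convMatrix_add (c d : Fin l → ℝ) :
    convMatrix n (c + d) = convMatrix n c + convMatrix n d := by
  ext r s
  simp only [convMatrix, Matrix.of_apply, Matrix.add_apply, ← Finset.sum_add_distrib]
  refine Finset.sum_congr rfl fun t _ => ?_
  split_ifs <;> simp

theorem convMatrix_smul (a : ℝ) (c : Fin l → ℝ) :
    convMatrix n (a • c) = a • convMatrix n c := by
  ext r s
  simp only [convMatrix, Matrix.of_apply, Matrix.smul_apply, smul_eq_mul, Finset.mul_sum]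
  refine Finset.sum_congr rfl fun t _ => ?_
  split_ifs <;> simp

/-- The pre-activation of a channel as a linear map in its filters. -/
noncomputable def convLayer (l : ℕ) (U : Matrix (Fin n) (Fin n₁) ℝ)
    (B : Matrix (Fin n₁) (Fin k) ℝ) : (Fin k → Fin l → ℝ) →ₗ[ℝ] Fin n → ℝ where
  toFun c := ∑ j, convMatrix n (c j) *ᵥ (U *ᵥ (fun p => B p j))
  map_add' c d := by
    simp only [Pi.add_apply, convMatrix_add, Matrix.add_mulVec, Finset.sum_add_distrib]
  map_smul' a c := by
    simp only [Pi.smul_apply, convMatrix_smul, Matrix.smul_mulVec, Finset.smul_sum,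
      RingHom.id_apply]

/-- Scaling a fixed family of filters, as a linear map in the scalars. -/
noncomputable def scaleFilters (g : Fin k → Fin l → ℝ) :
    (Fin k → ℝ) →ₗ[ℝ] Fin k → Fin l → ℝ where
  toFun γ j := γ j • g j
  map_add' γ δ := by ext j : 1; simp [add_smul]
  map_smul' a γ := by ext j : 1; simp [smul_smul]

theorem decoder_eq_layer (U : Matrix (Fin n) (Fin n₁) ℝ) (B : Matrix (Fin n₁) (Fin k) ℝ) :
    decoder l U B = layer fun _ => convLayer l U B := rfl

theorem fixedDecoder_eq_layer (U : Matrix (Fin n) (Fin n₁) ℝ) (B : Matrix (Fin n₁) (Fin k) ℝ)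
    (g : Fin k → Fin k → Fin l → ℝ) :
    fixedDecoder U B g = layer fun i => convLayer l U B ∘ₗ scaleFilters (g i) := rfl

end DeepDecoder

theorem theorem2 :
    ∃ K c : ℝ, 0 < K ∧ 0 < c ∧
      ∀ (m n n₁ k l : ℕ) (U : Matrix (Fin n) (Fin n₁) ℝ) (B : Matrix (Fin n₁) (Fin k) ℝ),
        (K * (l * (k : ℝ) ^ 2 * Real.log n) ≤ m →
          DeepDecoder.RecoversWithHighProb m c (DeepDecoder.decoder l U B)) ∧
        (∀ g : Fin k → Fin k → Fin l → ℝ, K * ((k : ℝ) ^ 2 * Real.log n) ≤ m →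
          DeepDecoder.RecoversWithHighProb m c (DeepDecoder.fixedDecoder U B g)) := by
  refine ⟨20000, 1 / 1000, by norm_num, by norm_num, fun m n n₁ k l U B => ⟨fun hm => ?_,
    fun g hm => ?_⟩⟩
  · rw [DeepDecoder.decoder_eq_layer]
    refine DeepDecoder.recoversWithHighProb_layer _ (le_trans (le_of_eq ?_) hm)
    -- A channel has `k * l` filter coefficients, hence `d = k * (k * l)`.
    simp only [Module.finrank_pi_fintype, Module.finrank_self, Finset.sum_const, Finset.card_univ,
      Fintype.card_fin, smul_eq_mul, mul_one]
    push_cast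
    ring
  · rw [DeepDecoder.fixedDecoder_eq_layer]
    refine DeepDecoder.recoversWithHighProb_layer _ (le_trans (le_of_eq ?_) hm)
    -- With fixed filters a channel has only `k` scalars, hence `d = k * k`.
    simp only [Module.finrank_pi_fintype, Module.finrank_self, Finset.sum_const, Finset.card_univ,
      Fintype.card_fin, smul_eq_mul, mul_one]
    push_cast
    ring
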